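/- **Conventions.** A function $\varepsilon:\mathbb N\to\mathbb R$ is negligible if $k^{d}\,\varepsilon(k)\to 0$ for every $d\in\mathbb N$. An interval function on $n$ bits is a map $I_{[a,b]}:\{0,1\}^n\to\{0,1\}$, with integers $0\le a<b<2^n$, that is $1$ exactly on the strings $x$ which, read as integers in binary, lie in $[a,b]$. The size $|C|$ of a Boolean circuit $C$ (fan-in-two gates, one output bit) is its number of inputs and gates. Let $\mathcal I$ be a class of circuits that compute interval functions and that contains, for every interval function on $n$ bits, a circuit of size at most $p(n)$ for some fixed polynomial $p$ (for instance the class of all circuits that compute interval functions). A transmission $O(C)$ consists of finitely many rounds; in each round the sender sends a quantum message of some number of qubits, produced from its memory. The memory bounds apply after each round (and before the first one): a party with qmemory $t$ must then reduce its stored state to a cq-state $\sum_y p_y|y\rangle\langle y|\otimes\rho_y$ with at most $t$ qubits. Otherwise the parties are unrestricted (arbitrary quantum channels, arbitrary finite classical memory). Receivers know the input length of $C$, the size $|C|$, and the number of rounds and message lengths. The bounds $q,r,\mathtt s$ may be functions of $|C|$. A family of transmissions $O_{\mathtt s}(C)$ is a $(q,r,\mathtt s)$-BQS obfuscator of $\mathcal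 I$ if: 1. some receiver with qmemory $r$ obtains, for every $C\in\mathcal I$ and every input $x$ of its choice, the value $C(x)$ from $O_{\mathtt s}(C)$ except with probability negligible in $|C|$; 2. the total number of qubits of $O_{\mathtt s}(C)$ is at most polynomial in $|C|$; 3. the sender needs qmemory at most $q$; 4. for every computationally unbounded adversary $\mathcal A$ with qmemory $\mathtt s$ and one-bit output there are a computationally unbounded quantum simulator $\mathcal S$ with qmemory $\mathtt s$ (at whatever fixed set of points between its queries the bound is taken to apply), making at most polynomially many (in $|C|$) quantum queries to an oracle for $C$, and a negligible $\varepsilon$ such that for all $C\in\mathcal I$ $$\bigl|\Pr[\mathcal A(O_{\mathtt s}(C))=1]-\Pr[\mathcal S^{C}(|0\rangle^{\otimes|C|})=1]\bigr|\le\varepsilon(|C|).$$ **Theorem.** Let $O_{\mathtt s}$ be a $(q,r,\mathtt s)$-BQS obfuscator of $\mathcal I$. There do not exist computationally unbounded algorithms $\mathcal A_{\mathtt s}$ (a receiver with qmemory $\mathtt s$) and $\mathcal A_{\mathtt s}'$ (a quantum channel with one-qubit output, for each input length, circuit size and transmission shape) and a negligible function $\varepsilon$ such that for every $C\in\mathcal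 I$: 1. after the transmission $O_{\mathtt s}(C)$, $\mathcal A_{\mathtt s}$ holds a cq-state $\rho_C$ with at most $\mathtt s(|C|)$ qubits; and 2. for every input $x$ of $C$, $$\bigl\|\mathcal A_{\mathtt s}'(\rho_C\otimes|x\rangle\langle x|)-|C(x)\rangle\langle C(x)|\bigr\|_1\le\varepsilon(|C|).$$ -/

import Mathlib

noncomputable section

open Matrix

namespace BQS

/-! ### Boolean circuits and interval functions -/

/-- Bit strings of length `n`; also the computational basis of an `n`-qubit register. -/
abbrev Bits (n : ℕ) : Type := Fin n → Bool

/-- Straight-line Boolean programs with `n` inputs and `k` wires in total: the inputs are the first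
`n` wires, and each fan-in-two gate reads two existing wires and creates a new one. -/
inductive Netlist (n : ℕ) : ℕ → Type
  | inputs : Netlist n n
  | gate {k : ℕ} (c : Netlist n k) (g : Bool → Bool → Bool) (i j : Fin k) : Netlist n (k + 1)

/-- The values of all wires on the input `x`. -/
def Netlist.eval {n : ℕ} (x : Bits n) : {k : ℕ} → Netlist n k → Fin k → Bool
  | _, .inputs => x
  | _, .gate c g i j => Fin.snoc (α := fun _ => Bool) (c.eval x) (g (c.eval x i) (c.eval x j))

/-- A Boolean circuit with `n` input bits and one output bit. Its size `|C|` is the number of its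
wires (inputs and gates). -/
structure BoolCircuit (n : ℕ) where
  size : ℕ
  net : Netlist n size
  out : Fin size

/-- The function computed by a circuit. -/
def BoolCircuit.eval {n : ℕ} (C : BoolCircuit n) (x : Bits n) : Bool := C.net.eval x C.out

/-- `f` is the indicator of `[a, b]` with `a < b`, where an `n`-bit string is read as an integer in
`{0, …, 2 ^ n - 1}` through its binary expansion. -/
def IsIntervalFunction {n : ℕ} (f : Bits n → Bool) : Prop :=
  ∃ a b : ℕ, a < b ∧ b < 2 ^ n ∧ ∀ x, f x = decide (a ≤ Nat.ofBits x ∧ Nat.ofBits x ≤ b)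

/-- A class of circuits implements the interval functions if all its members compute interval
functions and every interval function is computed by a member of size polynomial in the input
length. (The class of all circuits that compute interval functions is an example, and so is the
class that holds one comparator circuit for each interval.) -/
def IsIntervalClass (𝓘 : (n : ℕ) → Set (BoolCircuit n)) : Prop :=
  (∀ n, ∀ C ∈ 𝓘 n, IsIntervalFunction C.eval) ∧
  ∃ p : Polynomial ℕ, ∀ n, ∀ f : Bits n → Bool, IsIntervalFunction f →
    ∃ C ∈ 𝓘 n, C.eval = f ∧ C.size ≤ p.eval n

/-- Negligible functions: smaller than the inverse of every polynomial for large arguments. -/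
def Negligible (ε : ℕ → ℝ) : Prop :=
  Asymptotics.SuperpolynomialDecay Filter.atTop (fun k : ℕ => (k : ℝ)) ε

/-! ### States and channels on finite-dimensional systems -/

/-- A quantum channel (completely positive trace-preserving map), given by Kraus operators. -/
structure QChannel (α β : Type) [Fintype α] [DecidableEq α] [Fintype β] where
  num : ℕ
  kraus : Fin num → Matrix β α ℂ
  complete : ∑ i, (kraus i)ᴴ * kraus i = 1

section Channels

variable {α β γ : Type} [Fintype α] [DecidableEq α] [Fintype β]

/-- The action of a channel on an operator. -/
def QChannel.apply (Φ : QChannel α β) (ρ : Matrix α α ℂ) : Matrix β β ℂ :=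
  ∑ i, Φ.kraus i * ρ * (Φ.kraus i)ᴴ

/-- The action of `Φ ⊗ id` on a bipartite operator. -/
def QChannel.applyLeft [Fintype γ] [DecidableEq γ] (Φ : QChannel α β)
    (ρ : Matrix (α × γ) (α × γ) ℂ) : Matrix (β × γ) (β × γ) ℂ :=
  ∑ i, (kroneckerMap (· * ·) (Φ.kraus i) (1 : Matrix γ γ ℂ)) * ρ *
    (kroneckerMap (· * ·) (Φ.kraus i) (1 : Matrix γ γ ℂ))ᴴ

/-- The action of `id ⊗ Φ` on a bipartite operator. -/
def QChannel.applyRight [Fintype γ] [DecidableEq γ] (Φ : QChannel α β)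
    (ρ : Matrix (γ × α) (γ × α) ℂ) : Matrix (γ × β) (γ × β) ℂ :=
  ∑ i, (kroneckerMap (· * ·) (1 : Matrix γ γ ℂ) (Φ.kraus i)) * ρ *
    (kroneckerMap (· * ·) (1 : Matrix γ γ ℂ) (Φ.kraus i))ᴴ

end Channels

/-- The basis projection `|a⟩⟨a|`. -/
def proj {α : Type} [DecidableEq α] (a : α) : Matrix α α ℂ := Matrix.single a a 1

/-- The trace norm `tr √(M Mᴴ)`, that is, the sum of the square roots of the eigenvalues
of `M Mᴴ`. -/
def traceNorm {α : Type} [Fintype α] [DecidableEq α] (M : Matrix α α ℂ) : ℝ :=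
  ∑ i, √((isHermitian_mul_conjTranspose_self M).eigenvalues i)

/-- The partial trace over the first tensor factor. -/
def traceLeft {α β : Type} [Fintype α] (ρ : Matrix (α × β) (α × β) ℂ) : Matrix β β ℂ :=
  fun b b' => ∑ a, ρ (a, b) (a, b')

/-- The shape of a memory register: a classical part with `cl` values (arbitrary) and `qu`
qubits. -/
structure CQReg where
  cl : ℕ
  qu : ℕ

/-- The basis of a memory register. -/
abbrev CQReg.Basis (M : CQReg) : Type := Fin M.cl × Bits M.qu

/-- The classical part of a register is measured: the result is a cq-state
`∑ y, |y⟩⟨y| ⊗ ρ y`. -/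
def dephase {M : CQReg} (ρ : Matrix M.Basis M.Basis ℂ) : Matrix M.Basis M.Basis ℂ :=
  fun a b => if a.1 = b.1 then ρ a b else 0

/-- The classical parts of both registers of a bipartite system are measured. -/
def dephase₂ {M N : CQReg} (ρ : Matrix (M.Basis × N.Basis) (M.Basis × N.Basis) ℂ) :
    Matrix (M.Basis × N.Basis) (M.Basis × N.Basis) ℂ :=
  fun a b => if a.1.1 = b.1.1 ∧ a.2.1 = b.2.1 then ρ a b else 0

/-! ### Transmissions in the bounded quantum storage model -/

/-- The publicly visible shape of a transmission: the number of rounds and the number of qubits sent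
in each of them. The memory bounds apply after each round (and before the first one). Classical
messages are sent as qubits in a basis state. -/
structure Shape where
  rounds : ℕ
  len : Fin rounds → ℕ

/-- A sender. Between rounds it keeps a cq-register; in a round it acts on it by an arbitrary channel
that also produces the message of that round. -/
structure Transmission where
  shape : Shape
  mem : Fin (shape.rounds + 1) → CQReg
  init : QChannel Unit (mem 0).Basis
  step : (i : Fin shape.rounds) →
    QChannel (mem i.castSucc).Basis ((mem i.succ).Basis × Bits (shape.len i))

/-- The total number of qubits sent. -/
def Transmission.qubits (Θ : Transmission) : ℕ := ∑ i, Θ.shape.len i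

/-- A receiver for transmissions of a given shape. In a round it acts by an arbitrary channel on its
register and the message; whenever the memory bound applies, only a cq-register remains. -/
structure Receiver (sh : Shape) where
  mem : Fin (sh.rounds + 1) → CQReg
  init : QChannel Unit (mem 0).Basis
  step : (i : Fin sh.rounds) →
    QChannel ((mem i.castSucc).Basis × Bits (sh.len i)) (mem i.succ).Basis

/-- The register that is stored after the last round. -/
abbrev Receiver.final {sh : Shape} (A : Receiver sh) : CQReg := A.mem (Fin.last sh.rounds)

/-- The receiver never keeps more than `s` qubits when the memory bound applies; its classical memory
and its operations within a round are unrestricted. -/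
def Receiver.HasQMemory {sh : Shape} (A : Receiver sh) (s : ℕ) : Prop := ∀ i, (A.mem i).qu ≤ s

/-- The joint state of the memories of the sender and the receiver after `i` rounds. In each round
the sender produces a message, the receiver processes it, and the memory bounds apply. -/
def jointState (Θ : Transmission) (A : Receiver Θ.shape) (i : Fin (Θ.shape.rounds + 1)) :
    Matrix ((Θ.mem i).Basis × (A.mem i).Basis) ((Θ.mem i).Basis × (A.mem i).Basis) ℂ :=
  Fin.induction
    (motive := fun i =>
      Matrix ((Θ.mem i).Basis × (A.mem i).Basis) ((Θ.mem i).Basis × (A.mem i).Basis) ℂ)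
    (dephase₂ (kroneckerMap (· * ·) (Θ.init.apply 1) (A.init.apply 1)))
    (fun i ρ => dephase₂ ((A.step i).applyRight
      (((Θ.step i).applyLeft ρ).submatrix
        (fun a => ((a.1, a.2.2), a.2.1)) (fun a => ((a.1, a.2.2), a.2.1)))))
    i

/-- The cq-state that the receiver holds after the transmission. -/
def storedState (Θ : Transmission) (A : Receiver Θ.shape) :
    Matrix A.final.Basis A.final.Basis ℂ :=
  traceLeft (jointState Θ A (Fin.last Θ.shape.rounds))

/-- A computationally unbounded receiving algorithm with qmemory bound `s`. It knows the input length
`n` and the size `k` of the circuit, and sees the shape of the transmission. -/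
structure ReceiverFamily (s : ℕ → ℕ) where
  recv : (n k : ℕ) → (sh : Shape) → Receiver sh
  bound : ∀ n k sh, (recv n k sh).HasQMemory (s k)

/-- The probability that the one-qubit output of `D`, applied to the stored state and measured in the
computational basis, is `b`. -/
def outputProb (Θ : Transmission) (A : Receiver Θ.shape) (D : QChannel A.final.Basis Bool)
    (b : Bool) : ℝ :=
  (D.apply (storedState Θ A) b b).re

/-! ### Oracle algorithms -/

/-- A computationally unbounded quantum algorithm with input `k` qubits, a one-bit output, and a
number of queries to an oracle for a function on `n` bits. Between queries it keeps a
cq-register. -/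
structure OracleAlgorithm (n k : ℕ) where
  queries : ℕ
  mem : Fin (queries + 1) → CQReg
  work : Fin queries → ℕ
  init : QChannel (Bits k) (mem 0).Basis
  pre : (t : Fin queries) → QChannel (mem t.castSucc).Basis (Fin (work t) × Bits n × Bool)
  post : (t : Fin queries) → QChannel (Fin (work t) × Bits n × Bool) (mem t.succ).Basis
  out : QChannel (mem (Fin.last queries)).Basis Bool

/-- Conjugation with the oracle unitary `|x, b⟩ ↦ |x, b ⊕ f x⟩` on the last two registers. -/
def oracleCall {n : ℕ} {W : Type} (f : Bits n → Bool)
    (ρ : Matrix (W × Bits n × Bool) (W × Bits n × Bool) ℂ) :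
    Matrix (W × Bits n × Bool) (W × Bits n × Bool) ℂ :=
  ρ.submatrix (fun a => (a.1, a.2.1, xor a.2.2 (f a.2.1)))
    (fun a => (a.1, a.2.1, xor a.2.2 (f a.2.1)))

/-- The state of the memory after `t` queries, for the input `|0⟩^{⊗ k}`. -/
def OracleAlgorithm.state {n k : ℕ} (S : OracleAlgorithm n k) (f : Bits n → Bool)
    (t : Fin (S.queries + 1)) : Matrix (S.mem t).Basis (S.mem t).Basis ℂ :=
  Fin.induction (motive := fun t => Matrix (S.mem t).Basis (S.mem t).Basis ℂ)
    (dephase (S.init.apply (proj fun _ => false)))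
    (fun t ρ => dephase ((S.post t).apply (oracleCall f ((S.pre t).apply ρ))))
    t

/-- The probability that the algorithm outputs `1`. -/
def OracleAlgorithm.acceptProb {n k : ℕ} (S : OracleAlgorithm n k) (f : Bits n → Bool) : ℝ :=
  (S.out.apply (S.state f (Fin.last S.queries)) true true).re

/-- The algorithm keeps at most `s` qubits at the points where its memory bound applies; a point is
given by the number of queries made so far. -/
def OracleAlgorithm.HasQMemory {n k : ℕ} (S : OracleAlgorithm n k) (pts : Set ℕ) (s : ℕ) : Prop :=
  ∀ t : Fin (S.queries + 1), t.val ∈ pts → (S.mem t).qu ≤ s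

/-! ### BQS obfuscation -/

/-- `O` is a `(q, r, s)`-BQS obfuscator of the class `𝓕`; the bounds `q, r, s` may depend on the
size of the circuit. `pts` is the set of points at which the memory bound applies to the
simulator. -/
structure IsBQSObfuscator (pts : Set ℕ) (q r s : ℕ → ℕ)
    (𝓕 : (n : ℕ) → Set (BoolCircuit n)) (O : (n : ℕ) → BoolCircuit n → Transmission) : Prop where
  /-- A receiver with qmemory `r` learns the value of `C` at an input `x` of its choice. -/
  functionality : ∃ E : (n : ℕ) → Bits n → (k : ℕ) → (sh : Shape) → Receiver sh,
    (∀ n x k sh, (E n x k sh).HasQMemory (r k)) ∧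
    ∃ D : (n : ℕ) → (x : Bits n) → (k : ℕ) → (sh : Shape) → QChannel (E n x k sh).final.Basis Bool,
    ∃ ε : ℕ → ℝ, Negligible ε ∧ ∀ n, ∀ C ∈ 𝓕 n, ∀ x,
      1 - ε C.size ≤ outputProb (O n C) (E n x C.size (O n C).shape)
        (D n x C.size (O n C).shape) (C.eval x)
  /-- Polynomial slowdown. -/
  slowdown : ∃ p : Polynomial ℕ, ∀ n, ∀ C ∈ 𝓕 n, (O n C).qubits ≤ p.eval C.size
  /-- The sender needs qmemory `q`. -/
  sender : ∀ n, ∀ C ∈ 𝓕 n, ∀ i, ((O n C).mem i).qu ≤ q C.size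
  /-- Every adversary with qmemory `s` (a receiving strategy followed by a measurement) is simulated
  with polynomially many oracle queries. -/
  security : ∀ (A : ReceiverFamily s)
    (D : (n k : ℕ) → (sh : Shape) → QChannel (A.recv n k sh).final.Basis Bool),
    ∃ S : (n k : ℕ) → OracleAlgorithm n k,
      (∀ n k, (S n k).HasQMemory pts (s k)) ∧
      (∃ p : Polynomial ℕ, ∀ n k, (S n k).queries ≤ p.eval k) ∧
      ∃ ε : ℕ → ℝ, Negligible ε ∧ ∀ n, ∀ C ∈ 𝓕 n,
        |outputProb (O n C) (A.recv n C.size (O n C).shape) (D n C.size (O n C).shape) true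
          - (S n C.size).acceptProb C.eval| ≤ ε C.size

end BQS

end

/-!
A stored state that evaluates `C` on every input is used by an adversary that knows where to look.
For a set `J` of short intervals `[2 * j, 2 * j + 1]`, let `M j` be the effect of the event that
the evaluation at `2 * j` returns `1`, and put `S = ∑ j ∈ J, M j`. The effect `T = S (1 + S)⁻¹`
satisfies `M j ≤ 2 T` for `j ∈ J` and `T ≤ S`, so measuring `T` accepts with probability at least
about `1 / 2` if `C` computes a member of `J`, and with small probability if `C` computes another
short interval, as long as `|J|` times the evaluation error is small. Since that error is
negligible, `J` can be superpolynomially large.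

A simulator with `q` oracle queries cannot imitate this. The short intervals have disjoint supports,
so the weights that its queries to the zero oracle put on these supports add up to at most `q`;
hence only polynomially many short intervals are distinguished from the zero function, while the
simulator would have to distinguish from it all members of `J` or all of the at least as many
non-members. As the simulator depends on the size of `C`, the short intervals are first restricted
by pigeonhole to those with circuits of one common size.
-/

noncomputable section

open Matrix
open scoped ComplexOrder MatrixOrder

namespace BQS

section LoewnerOrder

variable {𝕜 m n : Type*} [RCLike 𝕜] [Fintype n]

theorem conj_add_le [Finite m] (A B : Matrix m n 𝕜) {σ : Matrix n n 𝕜} (hσ : σ.PosSemidef) {c : ℝ}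
    (hc : 0 < c) :
    (A + B) * σ * (A + B)ᴴ ≤ (1 + c) • (A * σ * Aᴴ) + (1 + c⁻¹) • (B * σ * Bᴴ) := by
  have hdiff : (1 + c) • (A * σ * Aᴴ) + (1 + c⁻¹) • (B * σ * Bᴴ) - (A + B) * σ * (A + B)ᴴ =
      c • ((A - c⁻¹ • B) * σ * (A - c⁻¹ • B)ᴴ) := by
    simp only [conjTranspose_add, conjTranspose_sub, conjTranspose_smul, star_trivial,
      Matrix.add_mul, Matrix.mul_add, Matrix.sub_mul, Matrix.mul_sub, Matrix.smul_mul,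
      Matrix.mul_smul, smul_sub, smul_smul, mul_inv_cancel₀ hc.ne', mul_inv_cancel_left₀ hc.ne']
    module
  rw [le_iff, hdiff]
  exact (hσ.mul_mul_conjTranspose_same _).smul hc.le

theorem conj_add_le_two_smul [Finite m] (A B : Matrix m n 𝕜) {σ : Matrix n n 𝕜}
    (hσ : σ.PosSemidef) :
    (A + B) * σ * (A + B)ᴴ ≤ (2 : ℝ) • (A * σ * Aᴴ + B * σ * Bᴴ) := by
  have h := conj_add_le A B hσ one_pos
  rwa [inv_one, one_add_one_eq_two, ← smul_add] at h

theorem neg_conj (A : Matrix m n 𝕜) (σ : Matrix n n 𝕜) : -A * σ * (-A)ᴴ = A * σ * Aᴴ := by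
  rw [conjTranspose_neg, Matrix.mul_neg, Matrix.neg_mul, Matrix.neg_mul, neg_neg]

theorem re_trace_mul_nonneg {T ρ : Matrix n n ℂ} (hT : T.PosSemidef) (hρ : ρ.PosSemidef) :
    0 ≤ (T * ρ).trace.re := by
  classical
  obtain ⟨B, rfl⟩ := CStarAlgebra.nonneg_iff_eq_star_mul_self.mp hT.nonneg
  rw [star_eq_conjTranspose, Matrix.mul_assoc, trace_mul_comm]
  exact (Complex.le_def.mp (hρ.mul_mul_conjTranspose_same B).trace_nonneg).1

theorem re_trace_mul_le_re_trace_mul {S T ρ : Matrix n n ℂ} (hST : S ≤ T) (hρ : ρ.PosSemidef) :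
    (S * ρ).trace.re ≤ (T * ρ).trace.re := by
  have h := re_trace_mul_nonneg (le_iff.mp hST) hρ
  rw [Matrix.sub_mul, trace_sub, Complex.sub_re] at h
  linarith

variable [DecidableEq n]

/-- The effect `S (1 + S)⁻¹`, written `1 - (1 + S)⁻¹`: a smooth version of the spectral event that
the positive operator `S` is not small. -/
def resolventEffect (S : Matrix n n 𝕜) : Matrix n n 𝕜 := 1 - (1 + S)⁻¹

theorem resolventEffect_le_one {S : Matrix n n 𝕜} (hS : 0 ≤ S) : resolventEffect S ≤ 1 :=
  sub_le_self _ (PosDef.one.add_posSemidef hS.posSemidef).inv.posSemidef.nonneg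

theorem isUnit_det_one_add {S : Matrix n n 𝕜} (hS : 0 ≤ S) : IsUnit (1 + S).det :=
  (isUnit_iff_isUnit_det _).mp (PosDef.one.add_posSemidef hS.posSemidef).isUnit

theorem inv_one_add_mul_self {S : Matrix n n 𝕜} (hS : 0 ≤ S) :
    (1 + S)⁻¹ * S = resolventEffect S := by
  have h := nonsing_inv_mul _ (isUnit_det_one_add hS)
  rw [Matrix.mul_add, Matrix.mul_one] at h
  exact eq_sub_of_add_eq' h

theorem resolventEffect_isHermitian {S : Matrix n n 𝕜} (hS : 0 ≤ S) :
    (resolventEffect S).IsHermitian :=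
  isHermitian_one.sub (PosDef.one.add_posSemidef hS.posSemidef).inv.isHermitian

theorem conj_inv_one_add_add_conj_resolventEffect {S : Matrix n n 𝕜} (hS : 0 ≤ S) :
    (1 + S)⁻¹ * S * ((1 + S)⁻¹)ᴴ + resolventEffect S * (resolventEffect S)ᴴ =
      resolventEffect S := by
  rw [(resolventEffect_isHermitian hS).eq,
    (PosDef.one.add_posSemidef hS.posSemidef).inv.isHermitian.eq, inv_one_add_mul_self hS,
    ← Matrix.mul_add, resolventEffect, add_sub_cancel, Matrix.mul_one]

theorem resolventEffect_nonneg {S : Matrix n n 𝕜} (hS : 0 ≤ S) : 0 ≤ resolventEffect S := by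
  rw [← conj_inv_one_add_add_conj_resolventEffect hS]
  exact add_nonneg (hS.posSemidef.mul_mul_conjTranspose_same _).nonneg
    (posSemidef_self_mul_conjTranspose _).nonneg

theorem resolventEffect_le_self {S : Matrix n n 𝕜} (hS : 0 ≤ S) : resolventEffect S ≤ S := by
  have hdiff : S - resolventEffect S = S * (1 + S)⁻¹ * Sᴴ := by
    have h := mul_nonsing_inv _ (isUnit_det_one_add hS)
    rw [Matrix.add_mul, Matrix.one_mul] at h
    rw [hS.posSemidef.isHermitian.eq, ← inv_one_add_mul_self hS, eq_sub_of_add_eq' h,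
      Matrix.sub_mul, Matrix.one_mul]
  rw [le_iff, hdiff]
  exact (PosDef.one.add_posSemidef hS.posSemidef).inv.posSemidef.mul_mul_conjTranspose_same S

theorem le_two_smul_resolventEffect {M S : Matrix n n 𝕜} (hM : 0 ≤ M) (hM1 : M ≤ 1)
    (hMS : M ≤ S) : M ≤ (2 : ℝ) • resolventEffect S := by
  set E : Matrix n n 𝕜 := (1 + S)⁻¹
  set T := resolventEffect S with hT
  calc M = (E + T) * M * (E + T)ᴴ := by simp [hT, resolventEffect, E]
    _ ≤ (2 : ℝ) • (E * M * Eᴴ + T * M * Tᴴ) := conj_add_le_two_smul E T hM.posSemidef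
    _ ≤ (2 : ℝ) • (E * S * Eᴴ + T * 1 * Tᴴ) := by
      gcongr
      · exact star_right_conjugate_le_conjugate hMS E
      · exact star_right_conjugate_le_conjugate hM1 T
    _ = (2 : ℝ) • T := by
      rw [Matrix.mul_one, conj_inv_one_add_add_conj_resolventEffect (hM.trans hMS)]

end LoewnerOrder

section TraceNorm

variable {α : Type} [Fintype α] [DecidableEq α]

theorem re_trace_mul_conjTranspose_self_le_traceNorm_sq (M : Matrix α α ℂ) :
    (M * Mᴴ).trace.re ≤ traceNorm M ^ 2 := by
  have hM := isHermitian_mul_conjTranspose_self M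
  calc (M * Mᴴ).trace.re = ∑ i, hM.eigenvalues i := by
        rw [hM.trace_eq_sum_eigenvalues, Complex.re_sum]
        rfl
    _ = ∑ i, √(hM.eigenvalues i) ^ 2 := Finset.sum_congr rfl fun i _ =>
        (Real.sq_sqrt ((posSemidef_self_mul_conjTranspose M).eigenvalues_nonneg i)).symm
    _ ≤ traceNorm M ^ 2 := Finset.sum_sq_le_sq_sum_of_nonneg fun i _ => Real.sqrt_nonneg _

theorem norm_apply_le_traceNorm (M : Matrix α α ℂ) (a b : α) : ‖M a b‖ ≤ traceNorm M := by
  refine le_of_sq_le_sq ?_ (Finset.sum_nonneg fun i _ => Real.sqrt_nonneg _)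
  calc ‖M a b‖ ^ 2 ≤ ∑ b, ‖M a b‖ ^ 2 :=
        Finset.single_le_sum (f := fun b => ‖M a b‖ ^ 2) (fun _ _ => by positivity)
          (Finset.mem_univ b)
    _ ≤ ∑ a, ∑ b, ‖M a b‖ ^ 2 :=
        Finset.single_le_sum (f := fun a => ∑ b, ‖M a b‖ ^ 2) (fun _ _ => by positivity)
          (Finset.mem_univ a)
    _ = (M * Mᴴ).trace.re := by
        simp [Matrix.trace, Matrix.mul_apply, Complex.mul_conj', ← Complex.ofReal_pow]
    _ ≤ traceNorm M ^ 2 := re_trace_mul_conjTranspose_self_le_traceNorm_sq M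

end TraceNorm

section Projections

variable {α : Type} [DecidableEq α]

theorem proj_eq_diagonal (a : α) : proj a = diagonal (Pi.single a 1) :=
  (diagonal_single a 1).symm

theorem proj_nonneg (a : α) : 0 ≤ proj a := by
  rw [proj_eq_diagonal]
  exact (PosSemidef.diagonal (Pi.single_nonneg.mpr zero_le_one)).nonneg

theorem proj_le_one (a : α) : proj a ≤ 1 := by
  rw [proj_eq_diagonal, le_iff, ← diagonal_one, diagonal_sub]
  refine PosSemidef.diagonal fun b => sub_nonneg.mpr ?_
  rw [Pi.single_apply]
  split_ifs <;> simp

theorem trace_proj [Fintype α] (a : α) : (proj a).trace = 1 :=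
  trace_single_eq_same a 1

theorem trace_proj_mul [Fintype α] (a : α) (ρ : Matrix α α ℂ) : (proj a * ρ).trace = ρ a a := by
  rw [proj, trace_single_mul, one_smul]

end Projections

section Channels

variable {α β γ : Type} [Fintype α] [DecidableEq α] [Fintype β]

/-- The Heisenberg-picture adjoint of a channel, which transforms observables instead of states. -/
def QChannel.dual (Φ : QChannel α β) (X : Matrix β β ℂ) : Matrix α α ℂ :=
  ∑ i, (Φ.kraus i)ᴴ * X * Φ.kraus i

theorem QChannel.trace_mul_apply (Φ : QChannel α β) (X : Matrix β β ℂ) (ρ : Matrix α α ℂ) :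
    (X * Φ.apply ρ).trace = (Φ.dual X * ρ).trace := by
  simp only [QChannel.apply, QChannel.dual, Matrix.mul_sum, Matrix.sum_mul, trace_sum]
  refine Finset.sum_congr rfl fun i _ => ?_
  rw [← Matrix.mul_assoc, trace_mul_comm]
  simp only [Matrix.mul_assoc]

theorem QChannel.dual_one [DecidableEq β] (Φ : QChannel α β) : Φ.dual 1 = 1 := by
  simp only [QChannel.dual, Matrix.mul_one, Φ.complete]

theorem QChannel.dual_mono (Φ : QChannel α β) : Monotone Φ.dual := fun X Y hXY => by
  refine Finset.sum_le_sum fun i _ => ?_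
  rw [le_iff, ← Matrix.sub_mul, ← Matrix.mul_sub]
  exact (le_iff.mp hXY).conjTranspose_mul_mul_same _

theorem QChannel.trace_apply (Φ : QChannel α β) (ρ : Matrix α α ℂ) :
    (Φ.apply ρ).trace = ρ.trace := by
  classical
  rw [← Matrix.one_mul (Φ.apply ρ), Φ.trace_mul_apply, Φ.dual_one, Matrix.one_mul]

theorem QChannel.apply_posSemidef (Φ : QChannel α β) {ρ : Matrix α α ℂ} (hρ : ρ.PosSemidef) :
    (Φ.apply ρ).PosSemidef :=
  posSemidef_sum _ fun _ _ => hρ.mul_mul_conjTranspose_same _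

section OutcomeEffect

variable [DecidableEq β] [Fintype γ] [DecidableEq γ]

/-- The operator on the first register whose expectation is the probability that `Φ` outputs `c`
when the second register is prepared in the basis state `x`. -/
def QChannel.outcomeEffect (Φ : QChannel (α × β) γ) (x : β) (c : γ) : Matrix α α ℂ :=
  (Φ.dual (proj c)).submatrix (·, x) (·, x)

theorem QChannel.outcomeEffect_nonneg (Φ : QChannel (α × β) γ) (x : β) (c : γ) :
    0 ≤ Φ.outcomeEffect x c := by
  have h : 0 ≤ Φ.dual (proj c) := by
    simpa [QChannel.dual] using Φ.dual_mono (proj_nonneg c)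
  exact (h.posSemidef.submatrix _).nonneg

theorem QChannel.outcomeEffect_le_one (Φ : QChannel (α × β) γ) (x : β) (c : γ) :
    Φ.outcomeEffect x c ≤ 1 := by
  have h : Φ.dual (proj c) ≤ 1 := Φ.dual_one ▸ Φ.dual_mono (proj_le_one c)
  have h1 : ((1 : Matrix (α × β) (α × β) ℂ).submatrix (·, x) (·, x)) = 1 :=
    submatrix_one _ (Prod.mk_left_injective x)
  rw [le_iff, QChannel.outcomeEffect, ← h1]
  exact (le_iff.mp h).submatrix _

theorem QChannel.apply_kronecker_proj (Φ : QChannel (α × β) γ) (ρ : Matrix α α ℂ) (x : β) (c : γ) :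
    Φ.apply (kroneckerMap (· * ·) ρ (proj x)) c c = (Φ.outcomeEffect x c * ρ).trace := by
  refine (trace_proj_mul c _).symm.trans ?_
  rw [Φ.trace_mul_apply]
  simp [QChannel.outcomeEffect, proj, Matrix.trace, Matrix.mul_apply, Fintype.sum_prod_type,
    Matrix.single_apply, ite_and]

end OutcomeEffect

section OfKraus

variable {ι : Type} [Fintype ι]

/-- The channel with a given Kraus family; the index type need not be `Fin`. -/
def QChannel.ofKraus (K : ι → Matrix β α ℂ) (hK : ∑ i, (K i)ᴴ * K i = 1) : QChannel α β where
  num := Fintype.card ι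
  kraus i := K ((Fintype.equivFin ι).symm i)
  complete := ((Fintype.equivFin ι).symm.sum_comp fun i => (K i)ᴴ * K i).trans hK

theorem QChannel.ofKraus_apply (K : ι → Matrix β α ℂ) (hK : ∑ i, (K i)ᴴ * K i = 1)
    (ρ : Matrix α α ℂ) : (ofKraus K hK).apply ρ = ∑ i, K i * ρ * (K i)ᴴ :=
  (Fintype.equivFin ι).symm.sum_comp fun i => K i * ρ * (K i)ᴴ

end OfKraus

theorem exists_channel_apply_true_eq_trace_mul {T : Matrix α α ℂ} (hT : 0 ≤ T) (hT1 : T ≤ 1) :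
    ∃ D : QChannel α Bool, ∀ ρ, D.apply ρ true true = (T * ρ).trace := by
  obtain ⟨A, hA⟩ := CStarAlgebra.nonneg_iff_eq_star_mul_self.mp hT
  obtain ⟨B, hB⟩ := CStarAlgebra.nonneg_iff_eq_star_mul_self.mp (sub_nonneg.mpr hT1)
  rw [star_eq_conjTranspose] at hA hB
  let R : Bool → Matrix α α ℂ := fun b => if b then A else B
  let K : Bool × α → Matrix Bool α ℂ := fun i => vecMulVec (Pi.single i.1 1) (R i.1 i.2)
  have hK : ∑ i, (K i)ᴴ * K i = 1 := by
    calc ∑ i, (K i)ᴴ * K i = Aᴴ * A + Bᴴ * B := by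
          ext c d
          simp [K, R, vecMulVec_apply, Matrix.sum_apply, Matrix.mul_apply, Fintype.sum_prod_type,
            Pi.single_apply]
      _ = 1 := by rw [← hA, ← hB, add_sub_cancel]
  refine ⟨.ofKraus K hK, fun ρ => ?_⟩
  rw [QChannel.ofKraus_apply, hA, Matrix.mul_assoc, trace_mul_comm]
  simp [K, R, vecMulVec_apply, Matrix.sum_apply, Matrix.mul_apply, Fintype.sum_prod_type,
    Matrix.trace, Pi.single_apply]

end Channels

section Positivity

variable {α β γ : Type}

theorem QChannel.applyLeft_posSemidef [Fintype α] [DecidableEq α] [Fintype β] [Fintype γ]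
    [DecidableEq γ] (Φ : QChannel α β) {ρ : Matrix (α × γ) (α × γ) ℂ} (hρ : ρ.PosSemidef) :
    (Φ.applyLeft ρ).PosSemidef :=
  posSemidef_sum _ fun _ _ => hρ.mul_mul_conjTranspose_same _

theorem QChannel.applyRight_posSemidef [Fintype α] [DecidableEq α] [Fintype β] [Fintype γ]
    [DecidableEq γ] (Φ : QChannel α β) {ρ : Matrix (γ × α) (γ × α) ℂ} (hρ : ρ.PosSemidef) :
    (Φ.applyRight ρ).PosSemidef :=
  posSemidef_sum _ fun _ _ => hρ.mul_mul_conjTranspose_same _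

theorem traceLeft_posSemidef [Fintype α] {ρ : Matrix (α × β) (α × β) ℂ} (hρ : ρ.PosSemidef) :
    (traceLeft ρ).PosSemidef := by
  have hsum : traceLeft ρ = ∑ a, ρ.submatrix (Prod.mk a) (Prod.mk a) := by
    ext b b'
    simp [traceLeft, Matrix.sum_apply]
  rw [hsum]
  exact posSemidef_sum _ fun a _ => hρ.submatrix _

theorem posSemidef_pinching {κ : Type} [DecidableEq κ] (g : α → κ)
    {ρ : Matrix α α ℂ} (hρ : ρ.PosSemidef) :
    (Matrix.of fun a b => if g a = g b then ρ a b else 0).PosSemidef := by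
  have hmask : ((1 : Matrix κ κ ℂ).submatrix g g).PosSemidef := PosSemidef.one.submatrix g
  have hmul : (Matrix.of fun a b => if g a = g b then ρ a b else 0) =
      ρ ⊙ (1 : Matrix κ κ ℂ).submatrix g g := by
    ext a b
    simp [Matrix.one_apply]
  rw [hmul]
  exact hρ.hadamard hmask

theorem dephase_posSemidef {M : CQReg} {ρ : Matrix M.Basis M.Basis ℂ} (hρ : ρ.PosSemidef) :
    (dephase ρ).PosSemidef :=
  posSemidef_pinching Prod.fst hρ

theorem dephase₂_posSemidef {M N : CQReg}
    {ρ : Matrix (M.Basis × N.Basis) (M.Basis × N.Basis) ℂ} (hρ : ρ.PosSemidef) :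
    (dephase₂ ρ).PosSemidef := by
  have h := posSemidef_pinching (fun a : M.Basis × N.Basis => (a.1.1, a.2.1)) hρ
  simp only [Prod.mk.injEq] at h
  exact h

theorem jointState_posSemidef (Θ : Transmission) (A : Receiver Θ.shape)
    (i : Fin (Θ.shape.rounds + 1)) : (jointState Θ A i).PosSemidef := by
  induction i using Fin.induction with
  | zero =>
    exact dephase₂_posSemidef
      ((Θ.init.apply_posSemidef .one).kronecker (A.init.apply_posSemidef .one))
  | succ i ih =>
    exact dephase₂_posSemidef ((A.step i).applyRight_posSemidef
      (((Θ.step i).applyLeft_posSemidef ih).submatrix _))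

theorem storedState_posSemidef (Θ : Transmission) (A : Receiver Θ.shape) :
    (storedState Θ A).PosSemidef :=
  traceLeft_posSemidef (jointState_posSemidef Θ A _)

end Positivity

section PositiveTracePreserving

variable {α β γ : Type} [Fintype α] [Fintype β] [Fintype γ]

/-- Density operators. -/
structure IsDensity (ρ : Matrix α α ℂ) : Prop where
  posSemidef : ρ.PosSemidef
  trace_eq_one : ρ.trace = 1

/-- Positive trace-preserving maps: the evolutions between two oracle queries, including those that
are not given as a `QChannel`, such as measuring a register and calling the oracle. -/
structure IsPTP (L : Matrix α α ℂ → Matrix β β ℂ) : Prop where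
  map_add : ∀ ρ σ, L (ρ + σ) = L ρ + L σ
  map_smul : ∀ (c : ℝ) ρ, L (c • ρ) = c • L ρ
  posSemidef : ∀ ρ, ρ.PosSemidef → (L ρ).PosSemidef
  trace_map : ∀ ρ, (L ρ).trace = ρ.trace

namespace IsPTP

theorem comp {L : Matrix β β ℂ → Matrix γ γ ℂ} {K : Matrix α α ℂ → Matrix β β ℂ}
    (hL : IsPTP L) (hK : IsPTP K) : IsPTP fun ρ => L (K ρ) where
  map_add ρ σ := by rw [hK.map_add, hL.map_add]
  map_smul c ρ := by rw [hK.map_smul, hL.map_smul]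
  posSemidef ρ hρ := hL.posSemidef _ (hK.posSemidef _ hρ)
  trace_map ρ := by rw [hL.trace_map, hK.trace_map]

variable {L : Matrix α α ℂ → Matrix β β ℂ}

theorem isDensity (hL : IsPTP L) {ρ : Matrix α α ℂ} (hρ : IsDensity ρ) : IsDensity (L ρ) :=
  ⟨hL.posSemidef ρ hρ.posSemidef, (hL.trace_map ρ).trans hρ.trace_eq_one⟩

theorem monotone (hL : IsPTP L) : Monotone L := fun ρ σ h => by
  rw [← add_sub_cancel ρ σ, hL.map_add]
  exact le_add_of_nonneg_right (hL.posSemidef _ (le_iff.mp h)).nonneg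

theorem re_apply_le_re_trace (hL : IsPTP L) {ρ : Matrix α α ℂ} (hρ : ρ.PosSemidef) (b : β) :
    (L ρ b b).re ≤ ρ.trace.re := by
  rw [← hL.trace_map, Matrix.trace, Complex.re_sum]
  exact Finset.single_le_sum (f := fun b => (L ρ b b).re)
    (fun b _ => (Complex.le_def.mp (hL.posSemidef ρ hρ).diag_nonneg).1) (Finset.mem_univ b)

end IsPTP

theorem QChannel.isPTP [DecidableEq α] (Φ : QChannel α β) : IsPTP Φ.apply where
  map_add ρ σ := by simp [QChannel.apply, Matrix.mul_add, Matrix.add_mul, Finset.sum_add_distrib]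
  map_smul c ρ := by simp [QChannel.apply, Finset.smul_sum]
  posSemidef _ := Φ.apply_posSemidef
  trace_map := Φ.trace_apply

theorem isPTP_dephase (M : CQReg) : IsPTP (dephase (M := M)) where
  map_add ρ σ := by ext a b; by_cases h : a.1 = b.1 <;> simp [dephase, h]
  map_smul c ρ := by ext a b; by_cases h : a.1 = b.1 <;> simp [dephase, h]
  posSemidef _ := dephase_posSemidef
  trace_map ρ := by simp [Matrix.trace, dephase]

theorem isPTP_submatrix (e : α ≃ α) : IsPTP fun ρ : Matrix α α ℂ => ρ.submatrix e e where
  map_add _ _ := rfl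
  map_smul _ _ := rfl
  posSemidef _ h := h.submatrix _
  trace_map ρ := e.sum_comp fun a => ρ a a

end PositiveTracePreserving

section Perturbation

variable {α β γ : Type} [Fintype α] [Fintype β] [Fintype γ]

theorem IsPTP.re_apply_conj_sub_le {L : Matrix α α ℂ → Matrix β β ℂ} (hL : IsPTP L)
    (A B : Matrix α γ ℂ) {σ : Matrix γ γ ℂ} (hσ : σ.PosSemidef)
    (hB : (B * σ * Bᴴ).trace.re ≤ 1) {c : ℝ} (hc : 0 < c) (b : β) :
    (L (A * σ * Aᴴ) b b).re - (L (B * σ * Bᴴ) b b).re ≤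
      c + (1 + c⁻¹) * ((A - B) * σ * (A - B)ᴴ).trace.re := by
  have hconj := hL.monotone (conj_add_le B (A - B) hσ hc)
  rw [add_sub_cancel, hL.map_add, hL.map_smul, hL.map_smul] at hconj
  have hentry := (Complex.le_def.mp ((le_iff.mp hconj).diag_nonneg (i := b))).1
  have hLB := hL.re_apply_le_re_trace (hσ.mul_mul_conjTranspose_same B) b
  have hLAB := hL.re_apply_le_re_trace (hσ.mul_mul_conjTranspose_same (A - B)) b
  simp only [Matrix.sub_apply, Matrix.add_apply, Matrix.smul_apply, Complex.sub_re, Complex.add_re,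
    Complex.smul_re, smul_eq_mul, Complex.zero_re] at hentry
  have hcLB := mul_le_mul_of_nonneg_left (hLB.trans hB) hc.le
  have hcLAB := mul_le_mul_of_nonneg_left hLAB (show 0 ≤ 1 + c⁻¹ by positivity)
  linarith

theorem IsPTP.abs_re_apply_conj_sub_le {L : Matrix α α ℂ → Matrix β β ℂ} (hL : IsPTP L)
    (A B : Matrix α γ ℂ) {σ : Matrix γ γ ℂ} (hσ : σ.PosSemidef)
    (hA : (A * σ * Aᴴ).trace.re ≤ 1) (hB : (B * σ * Bᴴ).trace.re ≤ 1) {c : ℝ} (hc : 0 < c)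
    (b : β) :
    |(L (A * σ * Aᴴ) b b).re - (L (B * σ * Bᴴ) b b).re| ≤
      c + (1 + c⁻¹) * ((A - B) * σ * (A - B)ᴴ).trace.re := by
  refine abs_sub_le_iff.mpr ⟨hL.re_apply_conj_sub_le A B hσ hB hc b, ?_⟩
  rw [← neg_conj (A - B), neg_sub]
  exact hL.re_apply_conj_sub_le B A hσ hA hc b

/-- The probability that measuring `σ` in the computational basis yields an element of `P`. -/
def weight (σ : Matrix α α ℂ) (P : α → Prop) [DecidablePred P] : ℝ :=
  ∑ a with P a, (σ a a).re

theorem sum_weight_le_re_trace {ι : Type} {σ : Matrix α α ℂ} (hσ : σ.PosSemidef) (H : Finset ι)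
    (P : ι → α → Prop) [∀ i, DecidablePred (P i)] (hP : ∀ a i j, P i a → P j a → i = j) :
    ∑ i ∈ H, weight σ (P i) ≤ σ.trace.re := by
  classical
  have hdisj : (H : Set ι).PairwiseDisjoint fun i => Finset.univ.filter (P i) :=
    fun i _ j _ hij => Finset.disjoint_filter.mpr fun a _ hi hj => hij (hP a i j hi hj)
  simp only [weight]
  rw [← Finset.sum_biUnion hdisj, Matrix.trace, Complex.re_sum]
  exact Finset.sum_le_sum_of_subset_of_nonneg (Finset.subset_univ _)
    fun a _ _ => (Complex.le_def.mp hσ.diag_nonneg).1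

theorem permMatrix_conj [DecidableEq α] (e : Equiv.Perm α) (σ : Matrix α α ℂ) :
    e.permMatrix ℂ * σ * (e.permMatrix ℂ)ᴴ = σ.submatrix e e := by
  rw [conjTranspose_permMatrix, Equiv.Perm.permMatrix, Equiv.Perm.permMatrix,
    PEquiv.toMatrix_toPEquiv_mul, PEquiv.mul_toMatrix_toPEquiv]
  rfl

theorem re_trace_conj_permMatrix_sub_one_le [DecidableEq α] {σ : Matrix α α ℂ}
    (hσ : σ.PosSemidef) (P : α → Prop) [DecidablePred P] (e : Equiv.Perm α)
    (he : ∀ a, ¬ P a → e a = a) :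
    ((e.permMatrix ℂ - 1) * σ * (e.permMatrix ℂ - 1)ᴴ).trace.re ≤ 4 * weight σ P := by
  set U := e.permMatrix ℂ
  let D : Matrix α α ℂ := diagonal fun a => if P a then 1 else 0
  have hfix : (U - 1) * D = U - 1 := by
    ext a b
    rw [mul_diagonal]
    by_cases hb : P b
    · rw [if_pos hb, mul_one]
    · have hab : e a = b ↔ a = b := by rw [← e.apply_eq_iff_eq (x := a), he b hb]
      simp [U, hb, Matrix.one_apply, hab]
  have hD : (D * σ * Dᴴ).trace.re = weight σ P := by
    simp [D, weight, Matrix.trace, diagonal_conjTranspose, mul_diagonal, diagonal_mul,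
      Finset.sum_filter, apply_ite Complex.re, ← ite_and]
  have hUD : (U * D * σ * (U * D)ᴴ).trace.re = weight σ P := by
    have hassoc : U * D * σ * (U * D)ᴴ = U * (D * σ * Dᴴ) * Uᴴ := by
      simp only [conjTranspose_mul, Matrix.mul_assoc]
    rw [hassoc, permMatrix_conj, (isPTP_submatrix e).trace_map, hD]
  have hle := (le_iff.mp (conj_add_le_two_smul (U * D) (-D) hσ)).trace_nonneg
  rw [← sub_eq_add_neg, ← sub_one_mul, hfix, neg_conj, trace_sub, trace_smul, trace_add] at hle
  have hle_re := (Complex.le_def.mp hle).1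
  simp only [Complex.zero_re, Complex.sub_re, Complex.smul_re, Complex.add_re, smul_eq_mul, hD,
    hUD] at hle_re
  linarith

theorem IsPTP.abs_re_apply_submatrix_sub_le {L : Matrix α α ℂ → Matrix β β ℂ} (hL : IsPTP L)
    {σ : Matrix α α ℂ} (hσ : IsDensity σ) (P : α → Prop) [DecidablePred P] (e : Equiv.Perm α)
    (he : ∀ a, ¬ P a → e a = a) {c : ℝ} (hc : 0 < c) (b : β) :
    |(L (σ.submatrix e e) b b).re - (L σ b b).re| ≤ c + 4 * (1 + c⁻¹) * weight σ P := by
  classical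
  have htrace : (σ.submatrix e e).trace.re ≤ 1 := by
    rw [((isPTP_submatrix e).isDensity hσ).trace_eq_one, Complex.one_re]
  have hconj_one : (1 : Matrix α α ℂ) * σ * 1ᴴ = σ := by simp
  have hpert := hL.abs_re_apply_conj_sub_le (e.permMatrix ℂ) 1 hσ.posSemidef
    (by rwa [permMatrix_conj]) (by rw [hconj_one, hσ.trace_eq_one, Complex.one_re]) hc b
  rw [permMatrix_conj, hconj_one] at hpert
  refine hpert.trans ?_
  have hdisp := mul_le_mul_of_nonneg_left
    (re_trace_conj_permMatrix_sub_one_le hσ.posSemidef P e he) (show 0 ≤ 1 + c⁻¹ by positivity)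
  linarith

end Perturbation

section QueryBound

variable {n k : ℕ}

/-- The oracle unitary `|x, b⟩ ↦ |x, b ⊕ f x⟩` as a permutation of the basis. -/
def oraclePerm {n : ℕ} (W : Type) (f : Bits n → Bool) : Equiv.Perm (W × Bits n × Bool) :=
  Function.Involutive.toPerm (fun a => (a.1, a.2.1, xor a.2.2 (f a.2.1))) fun a => by simp

theorem oraclePerm_apply_of_eq_false {W : Type} {f : Bits n → Bool} {a : W × Bits n × Bool}
    (ha : f a.2.1 = false) : oraclePerm W f a = a := by
  change (a.1, a.2.1, xor a.2.2 (f a.2.1)) = a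
  simp [ha]

namespace OracleAlgorithm

/-- The state on which the oracle is called for the query with index `t`. -/
def queryState (S : OracleAlgorithm n k) (f : Bits n → Bool) (t : Fin S.queries) :
    Matrix (Fin (S.work t) × Bits n × Bool) (Fin (S.work t) × Bits n × Bool) ℂ :=
  (S.pre t).apply (S.state f t.castSucc)

theorem state_succ (S : OracleAlgorithm n k) (f : Bits n → Bool) (t : Fin S.queries) :
    S.state f t.succ = dephase ((S.post t).apply
      ((S.queryState f t).submatrix (oraclePerm _ f) (oraclePerm _ f))) :=
  rfl

theorem isDensity_state (S : OracleAlgorithm n k) (f : Bits n → Bool) (t : Fin (S.queries + 1)) :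
    IsDensity (S.state f t) := by
  induction t using Fin.induction with
  | zero =>
    exact ((isPTP_dephase _).comp S.init.isPTP).isDensity
      ⟨(proj_nonneg _).posSemidef, trace_proj _⟩
  | succ t ih =>
    exact (((isPTP_dephase _).comp (S.post t).isPTP).comp ((isPTP_submatrix (oraclePerm _ f)).comp
      (S.pre t).isPTP)).isDensity ih

theorem isDensity_queryState (S : OracleAlgorithm n k) (f : Bits n → Bool) (t : Fin S.queries) :
    IsDensity (S.queryState f t) :=
  (S.pre t).isPTP.isDensity (S.isDensity_state f _)

/-- The probability that measuring the query with index `t` to the zero oracle yields a point of the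
support of `f`. -/
def queryWeight (S : OracleAlgorithm n k) (f : Bits n → Bool) (t : Fin S.queries) : ℝ :=
  weight (S.queryState (fun _ => false) t) fun a => f a.2.1 = true

theorem abs_re_apply_state_sub_le (S : OracleAlgorithm n k) (f : Bits n → Bool) {c : ℝ}
    (hc : 0 < c) (t : Fin (S.queries + 1)) {β : Type} [Fintype β]
    {L : Matrix (S.mem t).Basis (S.mem t).Basis ℂ → Matrix β β ℂ} (hL : IsPTP L) (b : β) :
    |(L (S.state f t) b b).re - (L (S.state (fun _ => false) t) b b).re| ≤
      ∑ i with i.castSucc < t, (c + 4 * (1 + c⁻¹) * S.queryWeight f i) := by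
  induction t using Fin.induction with
  | zero => simp [OracleAlgorithm.state]
  | succ t ih =>
    have hpost := hL.comp ((isPTP_dephase _).comp (S.post t).isPTP)
    have hearlier := ih ((hpost.comp (isPTP_submatrix (oraclePerm _ f))).comp (S.pre t).isPTP)
    have hcall := hpost.abs_re_apply_submatrix_sub_le (S.isDensity_queryState (fun _ => false) t)
      (fun a => f a.2.1 = true) (oraclePerm _ f)
      (fun a ha => oraclePerm_apply_of_eq_false (Bool.not_eq_true _ ▸ ha)) hc b
    have hzero : oraclePerm (Fin (S.work t)) (fun _ : Bits n => false) = Equiv.refl _ :=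
      Equiv.ext fun a => oraclePerm_apply_of_eq_false rfl
    have hfilter : (Finset.univ.filter fun i : Fin S.queries => i.castSucc < t.succ) =
        insert t (Finset.univ.filter fun i : Fin S.queries => i.castSucc < t.castSucc) := by
      ext i
      simp [Fin.castSucc_lt_succ_iff, le_iff_eq_or_lt]
    rw [hfilter, Finset.sum_insert (by simp), S.state_succ, S.state_succ, hzero, add_comm]
    exact (abs_sub_le _ _ _).trans (add_le_add hearlier hcall)

theorem abs_acceptProb_sub_le (S : OracleAlgorithm n k) (f : Bits n → Bool) {c : ℝ} (hc : 0 < c) :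
    |S.acceptProb f - S.acceptProb fun _ => false| ≤
      S.queries * c + 4 * (1 + c⁻¹) * ∑ t, S.queryWeight f t := by
  refine (S.abs_re_apply_state_sub_le f hc _ S.out.isPTP true).trans_eq ?_
  rw [Finset.filter_true_of_mem fun t _ => t.castSucc_lt_last, Finset.sum_add_distrib,
    Finset.mul_sum]
  simp

variable {ι : Type}

theorem sum_queryWeight_le (S : OracleAlgorithm n k) (H : Finset ι) {f : ι → Bits n → Bool}
    (hf : ∀ x i j, f i x = true → f j x = true → i = j) :
    ∑ i ∈ H, ∑ t, S.queryWeight (f i) t ≤ S.queries := by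
  rw [Finset.sum_comm]
  calc ∑ t, ∑ i ∈ H, S.queryWeight (f i) t ≤ ∑ _t : Fin S.queries, (1 : ℝ) := by
        refine Finset.sum_le_sum fun t _ => ?_
        have hquery := S.isDensity_queryState (fun _ => false) t
        exact (sum_weight_le_re_trace hquery.posSemidef H (fun i a => f i a.2.1 = true)
          fun a => hf a.2.1).trans_eq (by rw [hquery.trace_eq_one, Complex.one_re])
    _ = S.queries := by simp

theorem card_mul_sq_le_of_distinguishes (S : OracleAlgorithm n k) (H : Finset ι)
    {f : ι → Bits n → Bool} (hf : ∀ x i j, f i x = true → f j x = true → i = j) {η : ℝ}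
    (hη : 0 < η) (hH : ∀ i ∈ H, η ≤ |S.acceptProb (f i) - S.acceptProb fun _ => false|) :
    H.card * η ^ 2 ≤ 8 * S.queries * (2 * S.queries + 2 + η) := by
  set q : ℝ := (S.queries : ℝ)
  have : 0 ≤ q := Nat.cast_nonneg _
  have hsum : ∀ c : ℝ, 0 < c → H.card * η ≤ H.card * (q * c) + 4 * (1 + c⁻¹) * q := fun c hc => by
    calc H.card * η = ∑ _i ∈ H, η := by rw [Finset.sum_const, nsmul_eq_mul]
      _ ≤ ∑ i ∈ H, (q * c + 4 * (1 + c⁻¹) * ∑ t, S.queryWeight (f i) t) :=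
        Finset.sum_le_sum fun i hi => (hH i hi).trans (S.abs_acceptProb_sub_le (f i) hc)
      _ = H.card * (q * c) + 4 * (1 + c⁻¹) * ∑ i ∈ H, ∑ t, S.queryWeight (f i) t := by
        rw [Finset.sum_add_distrib, Finset.sum_const, nsmul_eq_mul, Finset.mul_sum]
      _ ≤ H.card * (q * c) + 4 * (1 + c⁻¹) * q := by
        gcongr
        exact S.sum_queryWeight_le H hf
  -- With this `c` the errors `q * c` of all queries together are at most `η / 2`.
  have hbound := hsum (η / (2 * (q + 1))) (by positivity)
  have hhalf : q * (η / (2 * (q + 1))) ≤ η / 2 := by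
    rw [← mul_div_assoc, div_le_div_iff₀ (by positivity) two_pos]
    nlinarith
  have hcard := mul_le_mul_of_nonneg_left hhalf (Nat.cast_nonneg (α := ℝ) H.card)
  rw [inv_div] at hbound
  have hlin : H.card * (η / 2) ≤ 4 * (1 + 2 * (q + 1) / η) * q := by linarith
  calc H.card * η ^ 2 = H.card * (η / 2) * (2 * η) := by ring
    _ ≤ 4 * (1 + 2 * (q + 1) / η) * q * (2 * η) := by gcongr
    _ = 8 * q * (2 * q + 2 + η) := by
      field_simp
      ring

theorem card_mul_sq_le_of_separates (S : OracleAlgorithm n k) {J J' : Finset ι}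
    (hcard : J.card ≤ J'.card) {f : ι → Bits n → Bool}
    (hf : ∀ x i j, f i x = true → f j x = true → i = j) {a b η : ℝ} (hη : 0 < η)
    (hab : a + 2 * η ≤ b) (hJ : ∀ j ∈ J, b ≤ S.acceptProb (f j))
    (hJ' : ∀ j ∈ J', S.acceptProb (f j) ≤ a) :
    J.card * η ^ 2 ≤ 8 * S.queries * (2 * S.queries + 2 + η) := by
  rcases le_total (S.acceptProb fun _ => false) (a + η) with h | h
  · refine S.card_mul_sq_le_of_distinguishes J hf hη fun j hj => le_trans ?_ (le_abs_self _)
    linarith [hJ j hj]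
  · have hcard' : (J.card : ℝ) * η ^ 2 ≤ J'.card * η ^ 2 := by gcongr
    refine hcard'.trans (S.card_mul_sq_le_of_distinguishes J' hf hη fun j hj =>
      le_trans ?_ (neg_le_abs _))
    linarith [hJ' j hj]

end OracleAlgorithm

end QueryBound

section Asymptotics

open Filter Topology

theorem monotone_eval_polynomial_nat (Q : Polynomial ℕ) : Monotone fun n => Q.eval n := by
  intro a b hab
  simp only [Polynomial.eval_eq_sum_range]
  gcongr

theorem negligible_half_pow : Negligible fun n => (1 / 2 : ℝ) ^ n := fun d =>
  tendsto_pow_const_mul_const_pow_of_abs_lt_one d (by norm_num [abs_of_pos])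

theorem Negligible.abs {ε : ℕ → ℝ} (hε : Negligible ε) : Negligible fun n => |ε n| := fun d => by
  simpa [abs_mul] using Filter.Tendsto.abs (hε d)

theorem Negligible.comp_of_le {ε : ℕ → ℝ} (hε : Negligible ε) {k : ℕ → ℕ} (hk : ∀ n, n ≤ k n) :
    Negligible fun n => ε (k n) := fun d => by
  have hlim := (hε d).comp (tendsto_atTop_mono hk tendsto_id)
  refine squeeze_zero_norm (fun n => ?_) (tendsto_zero_iff_norm_tendsto_zero.mp hlim)
  simp only [Function.comp_apply, norm_mul, norm_pow, Real.norm_natCast]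
  gcongr
  exact hk n

theorem Negligible.eventually_eval_mul_abs_lt {ε : ℕ → ℝ} (hε : Negligible ε) (Q : Polynomial ℕ)
    {η : ℝ} (hη : 0 < η) : ∀ᶠ n : ℕ in atTop, ((Q.eval n : ℕ) : ℝ) * |ε n| < η := by
  have hlim := ((hε.polynomial_mul (Q.map (Nat.castRingHom ℝ))) 0).abs
  refine (hlim.eventually_lt_const (by simpa using hη)).mono fun n hn => ?_
  simpa [abs_mul] using hn

theorem Negligible.eventually_abs_lt {ε : ℕ → ℝ} (hε : Negligible ε) {η : ℝ} (hη : 0 < η) :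
    ∀ᶠ n : ℕ in atTop, |ε n| < η := by
  simpa using hε.eventually_eval_mul_abs_lt 1 hη

/-- Growth beyond every polynomial, the counterpart of `Negligible` for natural numbers. -/
def Superpolynomial (m : ℕ → ℕ) : Prop := ∀ Q : Polynomial ℕ, ∀ᶠ n in atTop, Q.eval n < m n

theorem superpolynomial_two_pow : Superpolynomial fun n => 2 ^ n := fun Q => by
  refine (negligible_half_pow.eventually_eval_mul_abs_lt Q one_pos).mono fun n hn => ?_
  rw [abs_of_pos (by positivity), one_div, inv_pow, ← div_eq_mul_inv, div_lt_one (by positivity)]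
    at hn
  exact_mod_cast hn

theorem Superpolynomial.inf {m m' : ℕ → ℕ} (hm : Superpolynomial m) (hm' : Superpolynomial m') :
    Superpolynomial fun n => m n ⊓ m' n := fun Q =>
  (hm Q).mp ((hm' Q).mono fun _ h' h => lt_min h h')

theorem Superpolynomial.exists_subset {ι : Type} {m : ℕ → ℕ} (hm : Superpolynomial m)
    {G : ℕ → Finset ι} (hG : Superpolynomial fun n => (G n).card / 2) :
    ∃ J : ℕ → Finset ι, (∀ n, J n ⊆ G n ∧ (J n).card ≤ (G n).card / 2) ∧ (∀ n, (J n).card ≤ m n) ∧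
      Superpolynomial fun n => (J n).card := by
  choose J hJG hJ using fun n => Finset.exists_subset_card_eq
    (show m n ⊓ (G n).card / 2 ≤ (G n).card from inf_le_right.trans (Nat.div_le_self _ _))
  refine ⟨J, fun n => ⟨hJG n, (hJ n).trans_le inf_le_right⟩,
    fun n => (hJ n).trans_le inf_le_left, ?_⟩
  simpa only [hJ] using hm.inf hG

theorem Superpolynomial.of_le_mul_add {m m' : ℕ → ℕ} (hm : Superpolynomial m) (R T : Polynomial ℕ)
    (h : ∀ n, m n ≤ m' n * R.eval n + T.eval n) : Superpolynomial m' := fun Q => by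
  refine (hm (Q * R + T)).mono fun n hn => ?_
  rw [Polynomial.eval_add, Polynomial.eval_mul] at hn
  exact lt_of_mul_lt_mul_right (lt_of_add_lt_add_right (hn.trans_le (h n))) (Nat.zero_le _)

theorem Negligible.exists_superpolynomial_mul_le {ε : ℕ → ℝ} (hε : Negligible ε) {η : ℝ}
    (hη : 0 < η) : ∃ m : ℕ → ℕ, Superpolynomial m ∧ ∀ n, m n * |ε n| ≤ η := by
  have hpos : ∀ n, 0 < |ε n| + (1 / 2 : ℝ) ^ n := fun n => by positivity
  have hsum : Negligible fun n => |ε n| + (1 / 2 : ℝ) ^ n :=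
    hε.abs.add negligible_half_pow
  refine ⟨fun n => ⌊η / (|ε n| + (1 / 2 : ℝ) ^ n)⌋₊, fun Q => ?_, fun n => ?_⟩
  · refine (hsum.eventually_eval_mul_abs_lt (Q + 1) hη).mono fun n hn => ?_
    rw [abs_of_pos (hpos n), ← lt_div_iff₀ (hpos n), Polynomial.eval_add,
      Polynomial.eval_one] at hn
    exact Nat.le_floor hn.le
  · calc (⌊η / (|ε n| + (1 / 2 : ℝ) ^ n)⌋₊ : ℝ) * |ε n|
        ≤ η / (|ε n| + (1 / 2 : ℝ) ^ n) * (|ε n| + (1 / 2 : ℝ) ^ n) := by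
          gcongr
          · exact Nat.floor_le (div_nonneg hη.le (hpos n).le)
          · exact le_add_of_nonneg_right (by positivity)
      _ = η := div_mul_cancel₀ _ (hpos n).ne'

end Asymptotics

section ShortIntervals

/-- The indicator function of the interval `[2 * j, 2 * j + 1]`. The hard circuits for simulators
compute these functions: their supports are disjoint, and any two intervals are told apart by a
single point. -/
def shortInterval (n j : ℕ) (x : Bits n) : Bool := decide (Nat.ofBits x / 2 = j)

theorem isIntervalFunction_shortInterval {n j : ℕ} (hj : 2 * j + 1 < 2 ^ n) :
    IsIntervalFunction (shortInterval n j) :=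
  ⟨2 * j, 2 * j + 1, Nat.lt_succ_self _, hj, fun x => decide_eq_decide.mpr (by omega)⟩

theorem eq_of_shortInterval_eq_true {n : ℕ} (x : Bits n) (i j : ℕ)
    (hi : shortInterval n i x = true) (hj : shortInterval n j x = true) : i = j :=
  (of_decide_eq_true hi).symm.trans (of_decide_eq_true hj)

/-- The binary expansion of `2 * j`, a point of `[2 * j, 2 * j + 1]`. -/
def evenBits (n j : ℕ) : Bits n := fun i => (2 * j).testBit i

theorem shortInterval_evenBits {n i : ℕ} (hi : 2 * i < 2 ^ n) (j : ℕ) :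
    shortInterval n j (evenBits n i) = decide (i = j) := by
  have hval : Nat.ofBits (evenBits n i) = 2 * i :=
    (Nat.ofBits_testBit _ _).trans (Nat.mod_eq_of_lt hi)
  rw [shortInterval, hval, Nat.mul_div_cancel_left i two_pos]

theorem Netlist.le {n k : ℕ} (c : Netlist n k) : n ≤ k := by
  induction c with
  | inputs => exact le_rfl
  | gate _ _ _ _ ih => exact ih.trans (Nat.le_succ _)

/-- The indices of the short intervals on `n` bits that the class computes with circuits of size
`k`. -/
def shortIntervalsOfSize (𝓘 : (n : ℕ) → Set (BoolCircuit n)) (n k : ℕ) : Set ℕ :=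
  {j | 2 * j + 1 < 2 ^ n ∧ ∃ C ∈ 𝓘 n, C.eval = shortInterval n j ∧ C.size = k}

variable {𝓘 : (n : ℕ) → Set (BoolCircuit n)} {p : Polynomial ℕ}

theorem exists_finset_subset_shortIntervalsOfSize
    (hp : ∀ n, ∀ f : Bits n → Bool, IsIntervalFunction f →
      ∃ C ∈ 𝓘 n, C.eval = f ∧ C.size ≤ p.eval n) (n : ℕ) :
    ∃ k, n ≤ k ∧ k ≤ n + p.eval n ∧ ∃ G : Finset ℕ, ↑G ⊆ shortIntervalsOfSize 𝓘 n k ∧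
      2 ^ n / 2 ≤ G.card * (p.eval n + 1) := by
  have hsize : ∀ j ∈ Finset.range (2 ^ n / 2),
      ∃ k ∈ Finset.Icc n (n + p.eval n), j ∈ shortIntervalsOfSize 𝓘 n k := by
    intro j hj
    have hj' : 2 * j + 1 < 2 ^ n := by
      rw [Finset.mem_range] at hj
      omega
    obtain ⟨C, hC, hCj, hCsize⟩ := hp n _ (isIntervalFunction_shortInterval hj')
    exact ⟨C.size, Finset.mem_Icc.mpr ⟨C.net.le, hCsize.trans (Nat.le_add_left _ _)⟩, hj', C, hC,
      hCj, rfl⟩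
  choose! size hmem hshort using hsize
  obtain ⟨k, hk, hcard⟩ := Finset.exists_le_card_fiber_of_nsmul_le_card_of_maps_to
    (b := ((2 ^ n / 2 : ℕ) : ℚ) / (p.eval n + 1 : ℕ)) hmem ⟨n, by simp⟩ (by
      rw [Nat.card_Icc, Finset.card_range, nsmul_eq_mul, show n + p.eval n + 1 - n = p.eval n + 1 by
        omega, mul_div_cancel₀ _ (by positivity)])
  refine ⟨k, (Finset.mem_Icc.mp hk).1, (Finset.mem_Icc.mp hk).2,
    {j ∈ Finset.range (2 ^ n / 2) | size j = k}, fun j hj => ?_, ?_⟩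
  · obtain ⟨hj', rfl⟩ := Finset.mem_filter.mp hj
    exact hshort j hj'
  · rw [div_le_iff₀ (by positivity)] at hcard
    exact_mod_cast hcard

theorem exists_superpolynomial_shortIntervalsOfSize
    (hp : ∀ n, ∀ f : Bits n → Bool, IsIntervalFunction f →
      ∃ C ∈ 𝓘 n, C.eval = f ∧ C.size ≤ p.eval n) :
    ∃ k : ℕ → ℕ, (∀ n, n ≤ k n) ∧ (∀ n, k n ≤ n + p.eval n) ∧ ∃ G : ℕ → Finset ℕ,
      (∀ n, ↑(G n) ⊆ shortIntervalsOfSize 𝓘 n (k n)) ∧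
      Superpolynomial fun n => (G n).card / 2 := by
  choose k hnk hkp G hG hcard using exists_finset_subset_shortIntervalsOfSize hp
  refine ⟨k, hnk, hkp, G, hG, superpolynomial_two_pow.of_le_mul_add (4 * (p + 1)) (2 * (p + 1) + 1)
    fun n => ?_⟩
  simp only [Polynomial.eval_add, Polynomial.eval_mul, Polynomial.eval_one, Polynomial.eval_ofNat]
  calc 2 ^ n ≤ 2 * (2 ^ n / 2) + 1 := by omega
    _ ≤ 2 * ((2 * ((G n).card / 2) + 1) * (p.eval n + 1)) + 1 := by
      gcongr
      refine (hcard n).trans ?_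
      gcongr
      omega
    _ = (G n).card / 2 * (4 * (p.eval n + 1)) + (2 * (p.eval n + 1) + 1) := by ring

end ShortIntervals

section Detection

variable {α β ι : Type} [Fintype α] [DecidableEq α] [Fintype β] [DecidableEq β]

theorem QChannel.abs_re_trace_outcomeEffect_mul_sub_le (Φ : QChannel (α × β) Bool)
    {ρ : Matrix α α ℂ} {y : β} {b : Bool} {δ : ℝ}
    (hδ : traceNorm (Φ.apply (kroneckerMap (· * ·) ρ (proj y)) - proj b) ≤ δ) :
    |(Φ.outcomeEffect y true * ρ).trace.re - if b then 1 else 0| ≤ δ := by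
  have hentry := (norm_apply_le_traceNorm _ true true).trans hδ
  rw [Matrix.sub_apply, Φ.apply_kronecker_proj] at hentry
  refine le_trans (le_of_eq ?_) ((Complex.abs_re_le_norm _).trans hentry)
  cases b <;> simp [proj]

theorem exists_channel_detecting (Φ : QChannel (α × β) Bool) (J : Finset ι) (x : ι → β) :
    ∃ D : QChannel α Bool, ∀ (ρ : Matrix α α ℂ) (g : β → Bool) (δ : ℝ), ρ.PosSemidef →
      (∀ y, traceNorm (Φ.apply (kroneckerMap (· * ·) ρ (proj y)) - proj (g y)) ≤ δ) →
      (∀ j ∈ J, g (x j) = true → (1 - δ) / 2 ≤ (D.apply ρ true true).re) ∧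
      ((∀ j ∈ J, g (x j) = false) → (D.apply ρ true true).re ≤ J.card * δ) := by
  set M : ι → Matrix α α ℂ := fun j => Φ.outcomeEffect (x j) true
  have hM : ∀ j, 0 ≤ M j := fun j => Φ.outcomeEffect_nonneg _ _
  have hS : 0 ≤ ∑ j ∈ J, M j := Finset.sum_nonneg fun j _ => hM j
  obtain ⟨D, hD⟩ := exists_channel_apply_true_eq_trace_mul (resolventEffect_nonneg hS)
    (resolventEffect_le_one hS)
  refine ⟨D, fun ρ g δ hρ hg => ?_⟩
  have hprob : ∀ j, |(M j * ρ).trace.re - if g (x j) then 1 else 0| ≤ δ := fun j =>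
    Φ.abs_re_trace_outcomeEffect_mul_sub_le (hg (x j))
  rw [hD]
  refine ⟨fun j hj htrue => ?_, fun hfalse => ?_⟩
  · have hle := re_trace_mul_le_re_trace_mul (le_two_smul_resolventEffect (hM j)
      (Φ.outcomeEffect_le_one _ _) (Finset.single_le_sum (fun i _ => hM i) hj)) hρ
    rw [smul_mul, trace_smul, Complex.smul_re, smul_eq_mul] at hle
    have hj := (abs_le.mp (hprob j)).1
    rw [if_pos htrue] at hj
    linarith
  · calc (resolventEffect (∑ j ∈ J, M j) * ρ).trace.re
        ≤ ((∑ j ∈ J, M j) * ρ).trace.re :=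
          re_trace_mul_le_re_trace_mul (resolventEffect_le_self hS) hρ
      _ = ∑ j ∈ J, (M j * ρ).trace.re := by rw [Matrix.sum_mul, trace_sum, Complex.re_sum]
      _ ≤ ∑ _j ∈ J, δ := Finset.sum_le_sum fun j hj => by
          simpa [hfalse j hj] using (abs_le.mp (hprob j)).2
      _ = J.card * δ := by rw [Finset.sum_const, nsmul_eq_mul]

end Detection

section Obfuscation

variable {s : ℕ → ℕ} {𝓕 : (n : ℕ) → Set (BoolCircuit n)}
  {O : (n : ℕ) → BoolCircuit n → Transmission}

/-- The security clause of `IsBQSObfuscator` for simulators without a memory bound: every adversary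
with qmemory `s` is simulated with polynomially many oracle queries. -/
def IsSimulationSecure (s : ℕ → ℕ) (𝓕 : (n : ℕ) → Set (BoolCircuit n))
    (O : (n : ℕ) → BoolCircuit n → Transmission) : Prop :=
  ∀ (A : ReceiverFamily s)
    (D : (n k : ℕ) → (sh : Shape) → QChannel (A.recv n k sh).final.Basis Bool),
    ∃ S : (n k : ℕ) → OracleAlgorithm n k,
      (∃ p : Polynomial ℕ, ∀ n k, (S n k).queries ≤ p.eval k) ∧
      ∃ ε : ℕ → ℝ, Negligible ε ∧ ∀ n, ∀ C ∈ 𝓕 n,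
        |outputProb (O n C) (A.recv n C.size (O n C).shape) (D n C.size (O n C).shape) true
          - (S n C.size).acceptProb C.eval| ≤ ε C.size

theorem IsBQSObfuscator.isSimulationSecure {pts : Set ℕ} {q r : ℕ → ℕ}
    (hO : IsBQSObfuscator pts q r s 𝓕 O) : IsSimulationSecure s 𝓕 O := fun A D =>
  let ⟨S, _, hS⟩ := hO.security A D
  ⟨S, hS⟩

/-- The state that the receivers `A` store after the transmission of a circuit `C` of the class is a
program for `C`: the channels `A'` evaluate it on every input up to `ε C.size` in trace norm. -/
def EvaluatesFromStorage (𝓕 : (n : ℕ) → Set (BoolCircuit n))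
    (O : (n : ℕ) → BoolCircuit n → Transmission) (A : ReceiverFamily s)
    (A' : (n k : ℕ) → (sh : Shape) → QChannel ((A.recv n k sh).final.Basis × Bits n) Bool)
    (ε : ℕ → ℝ) : Prop :=
  ∀ n, ∀ C ∈ 𝓕 n, ∀ x : Bits n,
    traceNorm ((A' n C.size (O n C).shape).apply (kroneckerMap (· * ·)
      (storedState (O n C) (A.recv n C.size (O n C).shape)) (proj x)) - proj (C.eval x)) ≤ ε C.size

theorem IsSimulationSecure.exists_oracleAlgorithm_detecting (hO : IsSimulationSecure s 𝓕 O)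
    {A : ReceiverFamily s}
    {A' : (n k : ℕ) → (sh : Shape) → QChannel ((A.recv n k sh).final.Basis × Bits n) Bool}
    {ε : ℕ → ℝ} (hA : EvaluatesFromStorage 𝓕 O A A' ε) {ι : Type} (J : ℕ → Finset ι)
    (x : (n : ℕ) → ι → Bits n) :
    ∃ S : (n k : ℕ) → OracleAlgorithm n k,
      (∃ P : Polynomial ℕ, ∀ n k, (S n k).queries ≤ P.eval k) ∧
      ∃ ε' : ℕ → ℝ, Negligible ε' ∧ ∀ n, ∀ C ∈ 𝓕 n,
        (∀ j ∈ J n, C.eval (x n j) = true →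
          (1 - ε C.size) / 2 - ε' C.size ≤ (S n C.size).acceptProb C.eval) ∧
        ((∀ j ∈ J n, C.eval (x n j) = false) →
          (S n C.size).acceptProb C.eval ≤ (J n).card * ε C.size + ε' C.size) := by
  choose D hD using fun (n k : ℕ) (sh : Shape) => exists_channel_detecting (A' n k sh) (J n) (x n)
  obtain ⟨S, hP, ε', hε', hS⟩ := hO A D
  refine ⟨S, hP, ε', hε', fun n C hC => ?_⟩
  have hclose := abs_le.mp (hS n C hC)
  obtain ⟨htrue, hfalse⟩ := hD n C.size (O n C).shape _ C.eval (ε C.size)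
    (storedState_posSemidef _ _) (hA n C hC)
  rw [outputProb] at hclose
  refine ⟨fun j hj hCj => ?_, fun hCJ => ?_⟩
  · linarith [htrue j hj hCj]
  · linarith [hfalse hCJ]

end Obfuscation

theorem OracleAlgorithm.card_le_of_detecting {𝓘 : (n : ℕ) → Set (BoolCircuit n)} {n k : ℕ}
    (S : OracleAlgorithm n k) {J G : Finset ℕ} (hJG : J ⊆ G) (hcard : J.card ≤ G.card / 2)
    (hG : ↑G ⊆ shortIntervalsOfSize 𝓘 n k) {δ δ' : ℝ} (hδ : δ ≤ 1 / 16) (hδ' : δ' ≤ 1 / 16)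
    (hJδ : J.card * δ ≤ 1 / 16)
    (hS : ∀ C ∈ 𝓘 n, C.size = k →
      (∀ j ∈ J, C.eval (evenBits n j) = true → (1 - δ) / 2 - δ' ≤ S.acceptProb C.eval) ∧
      ((∀ j ∈ J, C.eval (evenBits n j) = false) → S.acceptProb C.eval ≤ J.card * δ + δ')) :
    J.card ≤ 512 * S.queries * (2 * S.queries + 3) := by
  have heval : ∀ i ∈ G, ∀ j, shortInterval n j (evenBits n i) = decide (i = j) := fun i hi =>
    shortInterval_evenBits ((Nat.lt_succ_self _).trans (hG hi).1)
  have haccept : ∀ j ∈ J, 13 / 32 ≤ S.acceptProb (shortInterval n j) := fun j hj => by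
    obtain ⟨-, C, hC, hCj, hk⟩ := hG (hJG hj)
    have hdetect := (hS C hC hk).1 j hj (by rw [hCj, heval j (hJG hj), decide_eq_true rfl])
    rw [hCj] at hdetect
    linarith
  have hreject : ∀ j ∈ G \ J, S.acceptProb (shortInterval n j) ≤ 1 / 8 := fun j hj => by
    obtain ⟨hjG, hjJ⟩ := Finset.mem_sdiff.mp hj
    obtain ⟨-, C, hC, hCj, hk⟩ := hG hjG
    have hdetect := (hS C hC hk).2 fun i hi => by
      rw [hCj, heval i (hJG hi), decide_eq_false (ne_of_mem_of_not_mem hi hjJ)]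
    rw [hCj] at hdetect
    linarith
  have hsdiff : J.card ≤ (G \ J).card := by
    rw [Finset.card_sdiff_of_subset hJG]
    omega
  have hbound := S.card_mul_sq_le_of_separates hsdiff eq_of_shortInterval_eq_true
    (η := 1 / 8) (by norm_num) (by norm_num) haccept hreject
  have hreal : (J.card : ℝ) ≤ 512 * S.queries * (2 * S.queries + 3) := by
    nlinarith [(Nat.cast_nonneg S.queries : (0 : ℝ) ≤ S.queries)]
  exact_mod_cast hreal

section Impossibility

variable {s : ℕ → ℕ} {𝓘 : (n : ℕ) → Set (BoolCircuit n)}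
  {O : (n : ℕ) → BoolCircuit n → Transmission}

theorem IsSimulationSecure.not_superpolynomial_card (hO : IsSimulationSecure s 𝓘 O)
    {A : ReceiverFamily s}
    {A' : (n k : ℕ) → (sh : Shape) → QChannel ((A.recv n k sh).final.Basis × Bits n) Bool}
    {ε : ℕ → ℝ} (hε : Negligible ε) (hA : EvaluatesFromStorage 𝓘 O A A' ε) {k : ℕ → ℕ}
    (hnk : ∀ n, n ≤ k n) {R : Polynomial ℕ} (hkR : ∀ n, k n ≤ R.eval n) {J G : ℕ → Finset ℕ}
    (hJG : ∀ n, J n ⊆ G n ∧ (J n).card ≤ (G n).card / 2)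
    (hG : ∀ n, ↑(G n) ⊆ shortIntervalsOfSize 𝓘 n (k n))
    (hJε : ∀ n, (J n).card * |ε (k n)| ≤ 1 / 16) : ¬ Superpolynomial fun n => (J n).card := by
  intro hJ
  obtain ⟨S, ⟨P, hP⟩, ε', hε', hS⟩ := hO.exists_oracleAlgorithm_detecting hA J evenBits
  have hqueries : ∀ n, (S n (k n)).queries ≤ (P.comp R).eval n := fun n =>
    (hP n (k n)).trans <|
      (monotone_eval_polynomial_nat P (hkR n)).trans_eq Polynomial.eval_comp.symm
  have hsmall : ∀ η : ℕ → ℝ, Negligible η → ∀ᶠ n in Filter.atTop, η (k n) ≤ 1 / 16 := fun η hη =>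
    ((hη.comp_of_le hnk).eventually_abs_lt (by norm_num)).mono fun n hn => le_of_abs_le hn.le
  obtain ⟨n, hlarge, hεn, hεn'⟩ := ((hJ (512 * P.comp R * (2 * P.comp R + 3))).and
    ((hsmall ε hε).and (hsmall ε' hε'))).exists
  have hJεn : (J n).card * ε (k n) ≤ 1 / 16 :=
    (mul_le_mul_of_nonneg_left (le_abs_self _) (Nat.cast_nonneg _)).trans (hJε n)
  have hcard := (S n (k n)).card_le_of_detecting (hJG n).1 (hJG n).2 (hG n) hεn hεn' hJεn
    fun C hC hk => hk ▸ hS n C hC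
  refine hlarge.not_ge (hcard.trans ?_)
  simp only [Polynomial.eval_add, Polynomial.eval_mul, Polynomial.eval_ofNat]
  gcongr <;> exact hqueries n

end Impossibility

end BQS

end

theorem mainTheorem5_general (s : ℕ → ℕ) (𝓘 : (n : ℕ) → Set (BQS.BoolCircuit n))
    (h𝓘 : ∃ p : Polynomial ℕ, ∀ n, ∀ f : BQS.Bits n → Bool, BQS.IsIntervalFunction f →
      ∃ C ∈ 𝓘 n, C.eval = f ∧ C.size ≤ p.eval n)
    (O : (n : ℕ) → BQS.BoolCircuit n → BQS.Transmission) (hO : BQS.IsSimulationSecure s 𝓘 O) :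
    ¬ ∃ (A : BQS.ReceiverFamily s)
        (A' : (n k : ℕ) → (sh : BQS.Shape) →
          BQS.QChannel ((A.recv n k sh).final.Basis × BQS.Bits n) Bool)
        (ε : ℕ → ℝ), BQS.Negligible ε ∧ BQS.EvaluatesFromStorage 𝓘 O A A' ε := by
  rintro ⟨A, A', ε, hε, hA⟩
  obtain ⟨p, hp⟩ := h𝓘
  obtain ⟨k, hnk, hkp, G, hG, hGcard⟩ := BQS.exists_superpolynomial_shortIntervalsOfSize hp
  obtain ⟨m, hm, hmε⟩ := (hε.comp_of_le hnk).exists_superpolynomial_mul_le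
    (show (0 : ℝ) < 1 / 16 by norm_num)
  obtain ⟨J, hJG, hJm, hJ⟩ := hm.exists_subset hGcard
  refine hO.not_superpolynomial_card hε hA hnk (R := Polynomial.X + p) (by simpa using hkp) hJG hG
    (fun n => ?_) hJ
  have hJmn : ((J n).card : ℝ) ≤ m n := Nat.cast_le.mpr (hJm n)
  exact (mul_le_mul_of_nonneg_right hJmn (abs_nonneg _)).trans (hmε n)

theorem mainTheorem5 (pts : Set ℕ) (q r s : ℕ → ℕ)
    (𝓘 : (n : ℕ) → Set (BQS.BoolCircuit n)) (h𝓘 : BQS.IsIntervalClass 𝓘)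
    (O : (n : ℕ) → BQS.BoolCircuit n → BQS.Transmission)
    (hO : BQS.IsBQSObfuscator pts q r s 𝓘 O) :
    ¬ ∃ (A : BQS.ReceiverFamily s)
        (A' : (n k : ℕ) → (sh : BQS.Shape) →
          BQS.QChannel ((A.recv n k sh).final.Basis × BQS.Bits n) Bool)
        (ε : ℕ → ℝ), BQS.Negligible ε ∧
        ∀ n, ∀ C ∈ 𝓘 n, ∀ x : BQS.Bits n,
          BQS.traceNorm
            ((A' n C.size (O n C).shape).apply
                (Matrix.kroneckerMap (· * ·)
                  (BQS.storedState (O n C) (A.recv n C.size (O n C).shape)) (BQS.proj x))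
              - BQS.proj (C.eval x)) ≤ ε C.size :=
  mainTheorem5_general s 𝓘 h𝓘.2 O hO.isSimulationSecure
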